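/- Let $p>1$ and $\alpha\ge 0$ be real numbers with $\alpha\neq p-1$. For every real sequence $u=(u_n)_{n\ge 0}$ with finite support and $u_0=0$, $$\sum_{n=1}^{\infty}|u_n-u_{n-1}|^p\,n^{\alpha}\;\ge\;\left|\frac{\alpha-p+1}{p}\right|^p\sum_{n=1}^{\infty}|u_n|^p\,n^{\alpha-p}.$$ The constant is sharp: $\left|\frac{\alpha-p+1}{p}\right|^p$ is the largest real number $A$ such that $$\sum_{n\ge1}|u_n-u_{n-1}|^p n^{\alpha}\ge A\sum_{n\ge1}|u_n|^p n^{\alpha-p}$$ for all such $u$; moreover, for every real $t<1$ there is such a sequence $u$ with $$\left|\frac{\alpha-p+1}{p}\right|^p\sum_{n\ge1}|u_n|^p n^{\alpha-p}>t\sum_{n\ge1}|u_n-u_{n-1}|^p n^{\alpha}.$$ It coincides with the sharp constant of the corresponding continuous inequality: $\left|\frac{\alpha-p+1}{p}\right|^p$ is also the largest real number $A$ such that $$\int_0^\infty|\varphi'(x)|^p x^{\alpha}\,dx\ge A\int_0^\infty|\varphi(x)|^p x^{\alpha-p}\,dx$$ for all real-valued $\varphi\in C_0^\infty(0,\infty)$,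 i.e. all smooth functions with compact support contained in $(0,\infty)$. -/

import Mathlib

open scoped ContDiff

/-- Real sequences `u = (u_n)_{n ≥ 0}` with finite support and `u_0 = 0`. -/
def HardySeq : Set (ℕ → ℝ) :=
  {u | u.support.Finite ∧ u 0 = 0}

/-- `∑_{n ≥ 1} |u_n - u_{n-1}|^p n^α`, indexed by `n = k + 1` with `k ≥ 0`. -/
noncomputable def discEnergy (p α : ℝ) (u : ℕ → ℝ) : ℝ :=
  ∑' k : ℕ, |u (k + 1) - u k| ^ p * ((k + 1 : ℕ) : ℝ) ^ α

/-- `∑_{n ≥ 1} |u_n|^p n^(α-p)`, indexed by `n = k + 1` with `k ≥ 0`. -/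
noncomputable def discPotential (p α : ℝ) (u : ℕ → ℝ) : ℝ :=
  ∑' k : ℕ, |u (k + 1)| ^ p * ((k + 1 : ℕ) : ℝ) ^ (α - p)

/-- The constants for which the discrete weighted `p`-Hardy inequality holds. -/
def discHardyConstants (p α : ℝ) : Set ℝ :=
  {A | ∀ u ∈ HardySeq, A * discPotential p α u ≤ discEnergy p α u}

/-- `C_0^∞(0, ∞)`: smooth real functions with compact support contained in `(0, ∞)`
(extended by zero to the real line). -/
def HardyTest : Set (ℝ → ℝ) :=
  {φ | ContDiff ℝ ∞ φ ∧ HasCompactSupport φ ∧ tsupport φ ⊆ Set.Ioi 0}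

/-- `∫_0^∞ |φ'(x)|^p x^α dx`. -/
noncomputable def contEnergy (p α : ℝ) (φ : ℝ → ℝ) : ℝ :=
  ∫ x in Set.Ioi (0 : ℝ), |deriv φ x| ^ p * x ^ α

/-- `∫_0^∞ |φ(x)|^p x^(α-p) dx`. -/
noncomputable def contPotential (p α : ℝ) (φ : ℝ → ℝ) : ℝ :=
  ∫ x in Set.Ioi (0 : ℝ), |φ x| ^ p * x ^ (α - p)

/-- The constants for which the continuous weighted `p`-Hardy inequality holds. -/
def contHardyConstants (p α : ℝ) : Set ℝ :=
  {A | ∀ φ ∈ HardyTest, A * contPotential p α φ ≤ contEnergy p α φ}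

/-!
Write `c = α - p + 1` and `γ = |c| / p`, so that the claimed constant is `γ ^ p`.

*The discrete inequality.* Young's inequality, used twice, bounds `|x - y| ^ p` from below by a
combination of `x ^ p` and `y ^ p` with two free parameters (`edge_inequality`). Applying it to
each pair of neighbouring values of `|u|` and summing by parts, the inequality follows as soon as
the parameters make the net coefficient of `|u n| ^ p` at least `γ ^ p * n ^ (α - p)`
(`hardy_of_edge`). The parameters follow the virtual extremal `n ^ (-c / p)`. For `c < 0`
(`disc_hardy_neg`) the edges are attached to their right end and the coefficient estimate is the
concavity of `x ^ δ` with `δ = |c| / (p - 1)`; here `δ ≤ 1` is exactly the hypothesis `0 ≤ α`.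
For `c > 0` the edges are attached to their left end. When `c ≤ 1`
(`disc_hardy_pos_of_le_one`) the concavity of `x ^ c` suffices, and when `c ≥ 1`
(`disc_hardy_pos_of_one_le`) the extremal is centred as `(n + 1 / 2) ^ (-γ)` and compared with
its derivative at midpoints (`rpow_sub_one_le_midpoint`).

*The continuous inequality.* For a test function `φ`, the energy and the potential of the
sequence `φ (k / N)`, both divided by `N ^ c`, are Riemann sums converging to the energy and the
potential of `φ`. So the continuous inequality is a limit of the discrete one (`cont_hardy`), and
almost equality for `φ` passes to its samples (`exists_hardySeq_of_hardyTest`).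

*Sharpness.* Thus it is enough to find almost extremal test functions. For
`φ x = x ^ (-c / p) * η (ε * log x)` with a bump function `η`, the substitution `x = exp s` gives
the energy `ε⁻¹ * ∫ |ε * η' - (c / p) * η| ^ p` and the potential `ε⁻¹ * ∫ |η| ^ p`, whose ratio
tends to `γ ^ p` as `ε → 0` (`exists_hardyTest_almost_equality`).
-/

/-! ### Edgewise lower bounds for the discrete energy -/

open Filter Topology MeasureTheory

theorem young_mul_rpow_sub_one {p a b : ℝ} (hp : 1 < p) (ha : 0 ≤ a) (hb : 0 ≤ b) :
    p * (a * b ^ (p - 1)) ≤ a ^ p + (p - 1) * b ^ p := by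
  have h0 : 0 < p := by linarith
  have h := Real.geom_mean_le_arith_mean2_weighted (w₁ := 1 / p) (w₂ := (p - 1) / p)
    (p₁ := a ^ p) (p₂ := b ^ p) (by positivity) (div_nonneg (by linarith) h0.le)
    (by positivity) (by positivity) (by field_simp; ring)
  rw [← Real.rpow_mul ha, ← Real.rpow_mul hb, mul_one_div_cancel h0.ne', Real.rpow_one,
    mul_div_cancel₀ _ h0.ne'] at h
  calc p * (a * b ^ (p - 1)) ≤ p * (1 / p * a ^ p + (p - 1) / p * b ^ p) := by gcongr
    _ = _ := by field_simp

/-- A two-parameter lower bound for the energy of one edge. Taking `μ = 1 - s` gives the discrete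
Picone inequality; the boundary case `μ = 0`, `y = 0` is allowed because it occurs at the edge
from `0` to `1`. -/
theorem edge_inequality {p x y s μ : ℝ} (hp : 1 < p) (hx : 0 ≤ x) (hy : 0 ≤ y) (hs : 0 ≤ s)
    (hμ : 0 < μ ∨ μ = 0 ∧ y = 0) :
    s ^ (p - 1) * ((p - (p - 1) * (μ + s)) * x ^ p - μ ^ (1 - p) * y ^ p) ≤ |x - y| ^ p := by
  have h1 := young_mul_rpow_sub_one hp (abs_nonneg (x - y)) (mul_nonneg hs hx)
  have h3 : p * ((x - y) * (s * x) ^ (p - 1)) ≤ p * (|x - y| * (s * x) ^ (p - 1)) := by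
    gcongr; exact le_abs_self _
  have hpow : ∀ {z : ℝ}, 0 ≤ z → z ^ p = z ^ (p - 1) * z := fun {z} hz => by
    conv_rhs => rw [← Real.rpow_add_one' hz (by linarith)]
    simp
  rw [Real.mul_rpow hs hx, Real.mul_rpow hs hx, hpow hs] at h1
  rw [Real.mul_rpow hs hx] at h3
  have h4 : p * (y * x ^ (p - 1)) ≤ μ ^ (1 - p) * y ^ p + (p - 1) * μ * x ^ p := by
    rcases hμ with hμ | ⟨rfl, rfl⟩
    swap
    · simp [Real.zero_rpow (show p ≠ 0 by linarith)]
    have h2 := young_mul_rpow_sub_one hp (div_nonneg hy hμ.le) hx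
    rw [Real.div_rpow hy hμ.le] at h2
    have := mul_le_mul_of_nonneg_left h2 hμ.le
    rw [Real.rpow_sub hμ, Real.rpow_one]
    calc p * (y * x ^ (p - 1)) = μ * (p * (y / μ * x ^ (p - 1))) := by field_simp
      _ ≤ _ := this
      _ = _ := by ring
  have h5 := mul_le_mul_of_nonneg_left h4 (Real.rpow_nonneg hs (p - 1))
  have h6 : x ^ (p - 1) * x = x ^ p := (hpow hx).symm
  have h7 : p * ((x - y) * (s ^ (p - 1) * x ^ (p - 1))) =
      s ^ (p - 1) * (p * x ^ p) - s ^ (p - 1) * (p * (y * x ^ (p - 1))) := by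
    rw [← h6]; ring
  linarith

theorem HardySeq.exists_bound {u : ℕ → ℝ} (hu : u ∈ HardySeq) : ∃ M, ∀ n, M ≤ n → u n = 0 := by
  obtain ⟨M, hM⟩ := hu.1.bddAbove
  refine ⟨M + 1, fun n hn => ?_⟩
  by_contra h
  have := hM (Function.mem_support.2 h)
  omega

/-- Summation by parts: if the energy of each edge `{k, k + 1}` is at least
`P k * |u k| ^ p - Q (k + 1) * |u (k + 1)| ^ p`, then the Hardy inequality holds with
the constant `C` once the net weights `P n - Q n`, `n ≥ 1`, dominate `C * n ^ (α - p)`. Passing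
to `|u|` only lowers the energy. -/
theorem hardy_of_edge {p α C : ℝ} (hp : 1 < p) {u : ℕ → ℝ} (hu : u ∈ HardySeq) (P Q : ℕ → ℝ)
    (hedge : ∀ k : ℕ, P k * |u k| ^ p - Q (k + 1) * |u (k + 1)| ^ p ≤
      |(|u k| - |u (k + 1)|)| ^ p * ((k + 1 : ℕ) : ℝ) ^ α)
    (hPQ : ∀ k : ℕ, C * ((k + 1 : ℕ) : ℝ) ^ (α - p) ≤ P (k + 1) - Q (k + 1)) :
    C * discPotential p α u ≤ discEnergy p α u := by
  have hp0 : p ≠ 0 := by linarith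
  obtain ⟨M, hM⟩ := HardySeq.exists_bound hu
  have hE : discEnergy p α u =
      ∑ k ∈ Finset.range M, |u (k + 1) - u k| ^ p * ((k + 1 : ℕ) : ℝ) ^ α := by
    refine tsum_eq_sum fun k hk => ?_
    have hk : M ≤ k := by simpa using hk
    simp [hM k hk, hM (k + 1) (by omega), Real.zero_rpow hp0]
  have hV : discPotential p α u =
      ∑ k ∈ Finset.range M, |u (k + 1)| ^ p * ((k + 1 : ℕ) : ℝ) ^ (α - p) := by
    refine tsum_eq_sum fun k hk => ?_
    have hk : M ≤ k := by simpa using hk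
    simp [hM (k + 1) (by omega), Real.zero_rpow hp0]
  have htel : ∑ k ∈ Finset.range M, (P (k + 1) * |u (k + 1)| ^ p - P k * |u k| ^ p) = 0 := by
    rw [Finset.sum_range_sub (fun k => P k * |u k| ^ p), hM M le_rfl, hu.2]
    simp [Real.zero_rpow hp0]
  rw [hE, hV, Finset.mul_sum, ← add_zero (∑ k ∈ Finset.range M, |u (k + 1) - u k| ^ p * _),
    ← htel, ← Finset.sum_add_distrib]
  refine Finset.sum_le_sum fun k _ => ?_
  have h1 := hedge k
  have h2 := mul_le_mul_of_nonneg_right (hPQ k) (Real.rpow_nonneg (abs_nonneg (u (k + 1))) p)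
  have h3 : |(|u k| - |u (k + 1)|)| ^ p * ((k + 1 : ℕ) : ℝ) ^ α ≤
      |u (k + 1) - u k| ^ p * ((k + 1 : ℕ) : ℝ) ^ α := by
    rw [abs_sub_comm (u (k + 1))]
    exact mul_le_mul_of_nonneg_right (Real.rpow_le_rpow (abs_nonneg _)
      (abs_abs_sub_abs_le _ _) (by linarith)) (by positivity)
  linarith

/-! ### Elementary inequalities for powers -/

theorem rpow_eq_rpow_sub_one_mul {γ : ℝ} (hγ : 0 < γ) (p : ℝ) : γ ^ p = γ ^ (p - 1) * γ := by
  rw [← Real.rpow_add_one hγ.ne', sub_add_cancel]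

theorem two_mul_le_rpow_sub_rpow_div {β t : ℝ} (hβ : β ≤ 1) (hβ0 : β ≠ 0) (ht : 0 ≤ t)
    (ht1 : t < 1) : 2 * t ≤ ((1 + t) ^ β - (1 - t) ^ β) / β := by
  have hd : ∀ x ∈ Set.Ico (0 : ℝ) 1, HasDerivAt
      (fun x : ℝ => ((1 + x) ^ β - (1 - x) ^ β) / β - 2 * x)
      ((1 + x) ^ (β - 1) + (1 - x) ^ (β - 1) - 2) x := by
    intro x hx
    have h1 := ((hasDerivAt_id x).const_add 1).rpow_const (p := β)
      (Or.inl (by simp; linarith [hx.1]))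
    have h2 := ((hasDerivAt_id x).const_sub 1).rpow_const (p := β)
      (Or.inl (by simp; linarith [hx.2]))
    refine HasDerivAt.congr_deriv
      (((h1.sub h2).div_const β).sub ((hasDerivAt_id x).const_mul 2)) ?_
    simp only [id]
    field_simp
    ring
  have hmono : MonotoneOn (fun x : ℝ => ((1 + x) ^ β - (1 - x) ^ β) / β - 2 * x)
      (Set.Ico 0 1) := by
    refine monotoneOn_of_deriv_nonneg (convex_Ico 0 1)
      (fun x hx => (hd x hx).continuousAt.continuousWithinAt)
      (fun x hx => (hd x (interior_subset hx)).differentiableAt.differentiableWithinAt) ?_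
    intro x hx
    have hx := interior_subset hx
    rw [(hd x hx).deriv]
    have ha : 0 < 1 + x := by linarith [hx.1]
    have hb : 0 < 1 - x := by linarith [hx.2]
    -- the product of the two powers is at least one, hence so is their arithmetic mean
    have hprod : 1 ≤ (1 + x) ^ (β - 1) * (1 - x) ^ (β - 1) := by
      rw [← Real.mul_rpow ha.le hb.le]
      exact Real.one_le_rpow_of_pos_of_le_one_of_nonpos (by positivity)
        (by nlinarith [sq_nonneg x]) (by linarith)
    nlinarith [sq_nonneg ((1 + x) ^ (β - 1) - (1 - x) ^ (β - 1)),
      Real.rpow_pos_of_pos ha (β - 1), Real.rpow_pos_of_pos hb (β - 1)]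
  have := hmono (Set.left_mem_Ico.2 one_pos) ⟨ht, ht1⟩ ht
  simp at this
  linarith

/-- The midpoint rule underestimates the integral of the convex function `x ^ (β - 1)` over an
interval of length one. Both signs of `β` are used. -/
theorem rpow_sub_one_le_midpoint {β m : ℝ} (hβ : β ≤ 1) (hβ0 : β ≠ 0) (hm : 1 / 2 < m) :
    m ^ (β - 1) ≤ ((m + 1 / 2) ^ β - (m - 1 / 2) ^ β) / β := by
  have hm0 : 0 < m := by linarith
  have ht1 : 1 / (2 * m) < 1 := by rw [div_lt_one (by positivity)]; linarith
  have h := two_mul_le_rpow_sub_rpow_div (t := 1 / (2 * m)) hβ hβ0 (by positivity) ht1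
  have e1 : m + 1 / 2 = m * (1 + 1 / (2 * m)) := by field_simp
  have e2 : m - 1 / 2 = m * (1 - 1 / (2 * m)) := by field_simp
  rw [e1, e2, Real.mul_rpow hm0.le (by positivity), Real.mul_rpow hm0.le (by linarith),
    Real.rpow_sub_one hm0.ne']
  calc m ^ β / m = m ^ β * (2 * (1 / (2 * m))) := by field_simp
    _ ≤ m ^ β * (((1 + 1 / (2 * m)) ^ β - (1 - 1 / (2 * m)) ^ β) / β) := by gcongr
    _ = _ := by ring

theorem mul_rpow_sub_one_le_sub_rpow {δ m : ℝ} (h0 : 0 ≤ δ) (h1 : δ ≤ 1) (hm : 1 ≤ m) :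
    δ * m ^ (δ - 1) ≤ m ^ δ - (m - 1) ^ δ := by
  have hm0 : 0 < m := by linarith
  have hi : 1 / m ≤ 1 := by rw [div_le_one hm0]; exact hm
  have h := rpow_one_add_le_one_add_mul_self (s := -(1 / m)) (by linarith) h0 h1
  have e : m - 1 = m * (1 + -(1 / m)) := by field_simp; ring
  rw [e, Real.mul_rpow hm0.le (by linarith), Real.rpow_sub_one hm0.ne']
  have := mul_le_mul_of_nonneg_left h (Real.rpow_nonneg hm0.le δ)
  have e2 : δ * (m ^ δ / m) = m ^ δ - m ^ δ * (1 + δ * -(1 / m)) := by field_simp; ring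
  linarith

/-! ### The discrete inequality -/

/-- The case `α < p - 1`, with `α = p - 1 - γ * p`. The edge `{k, k + 1}` is attached to its right
end, with `s = γ / (k + 1)` and `μ = (k / (k + 1)) ^ δ`; the choice of `δ` turns `μ ^ (1 - p)`
into `((k + 1) / k) ^ (γ * p)`, which makes the coefficient of `|u k| ^ p` a pure power of `k`. -/
theorem disc_hardy_neg {p γ : ℝ} (hp : 1 < p) (hγ : 0 < γ) (hα : 0 ≤ p - 1 - γ * p)
    {u : ℕ → ℝ} (hu : u ∈ HardySeq) :
    γ ^ p * discPotential p (p - 1 - γ * p) u ≤ discEnergy p (p - 1 - γ * p) u := by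
  have hp1 : 0 < p - 1 := by linarith
  have hp0 : p ≠ 0 := by linarith
  set δ := γ * p / (p - 1) with hδ
  have hδ0 : 0 < δ := by positivity
  have hδ1 : δ ≤ 1 := by rw [hδ, div_le_one hp1]; linarith
  have hδp : δ * (p - 1) = γ * p := by rw [hδ]; field_simp
  refine hardy_of_edge hp hu (fun n => -(γ ^ (p - 1) * (n : ℝ) ^ (-(γ * p))))
    (fun n => -(γ ^ (p - 1) * (n : ℝ) ^ (-(γ * p)) *
      (p - (p - 1) * (((n - 1) / n : ℝ) ^ δ + γ / n)))) ?_ ?_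
  · intro k
    have hm : (0 : ℝ) < ((k + 1 : ℕ) : ℝ) := by positivity
    have hpow : (γ / ((k + 1 : ℕ) : ℝ)) ^ (p - 1) * ((k + 1 : ℕ) : ℝ) ^ (p - 1 - γ * p) =
        γ ^ (p - 1) * ((k + 1 : ℕ) : ℝ) ^ (-(γ * p)) := by
      rw [Real.div_rpow hγ.le hm.le, sub_eq_add_neg (p - 1), Real.rpow_add hm]
      field_simp
    have e : ((k + 1 : ℕ) : ℝ) - 1 = k := by push_cast; ring
    have hμ : 0 < ((((k + 1 : ℕ) : ℝ) - 1) / ((k + 1 : ℕ) : ℝ)) ^ δ ∨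
        ((((k + 1 : ℕ) : ℝ) - 1) / ((k + 1 : ℕ) : ℝ)) ^ δ = 0 ∧ |u k| = 0 := by
      rcases Nat.eq_zero_or_pos k with rfl | hk
      · right
        simp [hu.2, Real.zero_rpow hδ0.ne']
      · left
        rw [e]
        positivity
    have h := edge_inequality hp (abs_nonneg (u (k + 1))) (abs_nonneg (u k))
      (div_nonneg hγ.le hm.le) hμ
    have h' := mul_le_mul_of_nonneg_right h (Real.rpow_nonneg hm.le (p - 1 - γ * p))
    have hμp : γ ^ (p - 1) * ((k + 1 : ℕ) : ℝ) ^ (-(γ * p)) *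
        (((((k + 1 : ℕ) : ℝ) - 1) / ((k + 1 : ℕ) : ℝ)) ^ δ) ^ (1 - p) * |u k| ^ p =
        γ ^ (p - 1) * (k : ℝ) ^ (-(γ * p)) * |u k| ^ p := by
      rcases Nat.eq_zero_or_pos k with rfl | hk
      · simp [hu.2, Real.zero_rpow hp0]
      · have hk : (0 : ℝ) < k := by exact_mod_cast hk
        rw [← Real.rpow_mul (by rw [e]; positivity), e,
          show δ * (1 - p) = -(γ * p) by linarith, Real.div_rpow hk.le hm.le]
        field_simp
    rw [abs_sub_comm |u k|]
    refine le_trans (le_of_eq ?_) h'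
    generalize (((((k + 1 : ℕ) : ℝ) - 1) / ((k + 1 : ℕ) : ℝ)) ^ δ) = μ at *
    linear_combination hμp - ((p - (p - 1) * (μ + γ / ((k + 1 : ℕ) : ℝ))) * |u (k + 1)| ^ p -
      μ ^ (1 - p) * |u k| ^ p) * hpow
  · intro k
    have hm : (0 : ℝ) < ((k + 1 : ℕ) : ℝ) := by positivity
    have hm1 : (1 : ℝ) ≤ ((k + 1 : ℕ) : ℝ) := by simp
    have hB := mul_rpow_sub_one_le_sub_rpow hδ0.le hδ1 hm1
    generalize ((k + 1 : ℕ) : ℝ) = m at *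
    have hB' : δ / m ≤ 1 - ((m - 1) / m) ^ δ := by
      rw [Real.div_rpow (by linarith) hm.le]
      rw [Real.rpow_sub_one hm.ne'] at hB
      have : 0 < m ^ δ := by positivity
      field_simp
      field_simp at hB
      linarith
    -- `(p - 1) * δ = γ * p` leaves exactly `γ * p - (p - 1) * γ = γ`
    have h1 : γ / m ≤ (p - 1) * (1 - ((m - 1) / m) ^ δ - γ / m) := by
      have := mul_le_mul_of_nonneg_left hB' hp1.le
      have e : (p - 1) * (δ / m) = p * (γ / m) := by
        rw [← mul_div_assoc, mul_comm (p - 1), hδp]; ring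
      linarith
    have h2 := mul_le_mul_of_nonneg_left h1
      (show 0 ≤ γ ^ (p - 1) * m ^ (-(γ * p)) by positivity)
    have e : m ^ (p - 1 - γ * p - p) = m ^ (-(γ * p)) / m := by
      rw [← Real.rpow_sub_one hm.ne']; ring_nf
    rw [e, rpow_eq_rpow_sub_one_mul hγ p]
    calc _ = γ ^ (p - 1) * m ^ (-(γ * p)) * (γ / m) := by ring
      _ ≤ _ := h2
      _ = _ := by ring

/-- The case `α = p - 1 + γ * p` with `γ * p ≤ 1`. The edge `{k, k + 1}` is attached to its left
end, with `s = γ / k` and `μ = 1`, and its weight `(k + 1) ^ α` is lowered to `k ^ α`. -/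
theorem disc_hardy_pos_of_le_one {p γ : ℝ} (hp : 1 < p) (hγ : 0 < γ) (hc : γ * p ≤ 1)
    {u : ℕ → ℝ} (hu : u ∈ HardySeq) :
    γ ^ p * discPotential p (p - 1 + γ * p) u ≤ discEnergy p (p - 1 + γ * p) u := by
  have hp0 : p ≠ 0 := by linarith
  have hc0 : 0 < γ * p := by positivity
  refine hardy_of_edge hp hu
    (fun n => γ ^ (p - 1) * (n : ℝ) ^ (γ * p) * (1 - (p - 1) * (γ / n)))
    (fun n => γ ^ (p - 1) * ((n : ℝ) - 1) ^ (γ * p)) ?_ ?_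
  · intro k
    -- at `k = 0` the left term has `u 0 = 0`, the right one the weight `0 ^ (γ * p) = 0`
    rcases Nat.eq_zero_or_pos k with rfl | hk
    · simp only [hu.2, abs_zero, Real.zero_rpow hp0, mul_zero, zero_sub]
      refine le_trans (neg_nonpos.2 ?_) (by positivity)
      simp [Real.zero_rpow hc0.ne']
    have hk : (0 : ℝ) < k := by exact_mod_cast hk
    have h := edge_inequality (μ := 1) hp (abs_nonneg (u k)) (abs_nonneg (u (k + 1)))
      (div_nonneg hγ.le hk.le) (Or.inl one_pos)
    have h' := mul_le_mul_of_nonneg_right h (Real.rpow_nonneg hk.le (p - 1 + γ * p))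
    have hpow : (γ / k) ^ (p - 1) * (k : ℝ) ^ (p - 1 + γ * p) =
        γ ^ (p - 1) * (k : ℝ) ^ (γ * p) := by
      rw [Real.div_rpow hγ.le hk.le, Real.rpow_add hk]
      field_simp
    have hmono : (k : ℝ) ^ (p - 1 + γ * p) ≤ ((k + 1 : ℕ) : ℝ) ^ (p - 1 + γ * p) := by
      refine Real.rpow_le_rpow hk.le (by simp) (by linarith)
    refine le_trans (le_trans (le_of_eq ?_) h')
      (mul_le_mul_of_nonneg_left hmono (by positivity))
    rw [Real.one_rpow, show ((k + 1 : ℕ) : ℝ) - 1 = k by push_cast; ring]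
    linear_combination -((p - (p - 1) * (1 + γ / k)) * |u k| ^ p - 1 * |u (k + 1)| ^ p) * hpow
  · intro k
    have hm : (0 : ℝ) < ((k + 1 : ℕ) : ℝ) := by positivity
    have hm1 : (1 : ℝ) ≤ ((k + 1 : ℕ) : ℝ) := by simp
    generalize ((k + 1 : ℕ) : ℝ) = m at *
    have h := mul_le_mul_of_nonneg_left (mul_rpow_sub_one_le_sub_rpow hc0.le hc hm1)
      (Real.rpow_nonneg hγ.le (p - 1))
    rw [show p - 1 + γ * p - p = γ * p - 1 by ring, rpow_eq_rpow_sub_one_mul hγ p]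
    rw [Real.rpow_sub_one hm.ne'] at h ⊢
    calc _ = γ ^ (p - 1) * (γ * p * (m ^ (γ * p) / m)) -
          γ ^ (p - 1) * m ^ (γ * p) * ((p - 1) * (γ / m)) := by ring
      _ ≤ _ := by linarith

/-- The case `α = p - 1 + γ * p` with `1 ≤ γ * p`. With `w x = x ^ (-γ)`, the edge `{k, k + 1}` is
attached to its left end with `s = -w' (k + 1) / w (k + 1 / 2)` and `μ = 1 - s`, that is, Picone's
inequality for the supersolution `w (k + 1 / 2)` with the slope at the midpoint of the edge. -/
theorem disc_hardy_pos_of_one_le {p γ : ℝ} (hp : 1 < p) (hγ : 0 < γ) (hc : 1 ≤ γ * p)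
    {u : ℕ → ℝ} (hu : u ∈ HardySeq) :
    γ ^ p * discPotential p (p - 1 + γ * p) u ≤ discEnergy p (p - 1 + γ * p) u := by
  refine hardy_of_edge hp hu
    (fun n => γ ^ (p - 1) * ((n : ℝ) + 1) ^ γ * ((n : ℝ) + 1 / 2) ^ (γ * (p - 1)))
    (fun n => γ ^ (p - 1) * (n : ℝ) ^ γ * ((n : ℝ) + 1 / 2) ^ (γ * (p - 1))) ?_ ?_
  · intro k
    push_cast
    generalize hm : (k : ℝ) + 1 = m
    have hm1 : 1 ≤ m := by rw [← hm]; simp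
    rw [show (k : ℝ) + 1 / 2 = m - 1 / 2 by linarith]
    have hm0 : 0 < m := by linarith
    have ha : 0 < m - 1 / 2 := by linarith
    have hb : 0 < m + 1 / 2 := by linarith
    set s := γ * m ^ (-γ - 1) * (m - 1 / 2) ^ γ with hs
    have hs0 : 0 ≤ s := by positivity
    have hmid := rpow_sub_one_le_midpoint (β := -γ) (m := m) (by linarith) (by linarith)
      (by linarith)
    -- the discrete slope of `x ^ (-γ)` dominates its derivative at the midpoint
    have hratio : ((m - 1 / 2) / (m + 1 / 2)) ^ γ ≤ 1 - s := by
      rw [Real.div_rpow ha.le hb.le, hs]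
      rw [Real.rpow_neg hb.le, Real.rpow_neg ha.le] at hmid
      have hA : 0 < (m - 1 / 2) ^ γ := by positivity
      have hB : 0 < (m + 1 / 2) ^ γ := by positivity
      have := mul_le_mul_of_nonneg_left hmid (show 0 ≤ γ * (m - 1 / 2) ^ γ by positivity)
      have e : γ * (m - 1 / 2) ^ γ * ((((m + 1 / 2) ^ γ)⁻¹ - ((m - 1 / 2) ^ γ)⁻¹) / -γ) =
          1 - (m - 1 / 2) ^ γ / (m + 1 / 2) ^ γ := by
        generalize (m - 1 / 2) ^ γ = A at hA
        generalize (m + 1 / 2) ^ γ = B at hB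
        field_simp
        ring
      linarith
    have hr0 : 0 < ((m - 1 / 2) / (m + 1 / 2)) ^ γ := by positivity
    have h := edge_inequality (μ := 1 - s) hp (abs_nonneg (u k)) (abs_nonneg (u (k + 1)))
      hs0 (Or.inl (by linarith))
    have hμ : (1 - s) ^ (1 - p) ≤ (m + 1 / 2) ^ (γ * (p - 1)) / (m - 1 / 2) ^ (γ * (p - 1)) := by
      refine (Real.rpow_le_rpow_of_nonpos hr0 hratio (by linarith)).trans (le_of_eq ?_)
      rw [← Real.rpow_mul (by positivity), show γ * (1 - p) = -(γ * (p - 1)) by ring,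
        Real.rpow_neg (by positivity), Real.div_rpow ha.le hb.le, inv_div]
    have hpow : s ^ (p - 1) * m ^ (p - 1 + γ * p) =
        γ ^ (p - 1) * m ^ γ * (m - 1 / 2) ^ (γ * (p - 1)) := by
      rw [hs, Real.mul_rpow (by positivity) (by positivity),
        Real.mul_rpow (by positivity) (by positivity), ← Real.rpow_mul hm0.le,
        ← Real.rpow_mul ha.le]
      have : m ^ ((-γ - 1) * (p - 1)) * m ^ (p - 1 + γ * p) = m ^ γ := by
        rw [← Real.rpow_add hm0]; ring_nf
      linear_combination γ ^ (p - 1) * (m - 1 / 2) ^ (γ * (p - 1)) * this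
    have h' := mul_le_mul_of_nonneg_right h (Real.rpow_nonneg hm0.le (p - 1 + γ * p))
    refine le_trans ?_ h'
    have hA : 0 < (m - 1 / 2) ^ (γ * (p - 1)) := by positivity
    have h1 : (1 - s) ^ (1 - p) * |u (k + 1)| ^ p ≤
        (m + 1 / 2) ^ (γ * (p - 1)) / (m - 1 / 2) ^ (γ * (p - 1)) * |u (k + 1)| ^ p := by
      gcongr
    have h2 := mul_le_mul_of_nonneg_left h1
      (show 0 ≤ γ ^ (p - 1) * m ^ γ * (m - 1 / 2) ^ (γ * (p - 1)) by positivity)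
    have h3 : γ ^ (p - 1) * m ^ γ * (m - 1 / 2) ^ (γ * (p - 1)) *
        ((m + 1 / 2) ^ (γ * (p - 1)) / (m - 1 / 2) ^ (γ * (p - 1)) * |u (k + 1)| ^ p) =
        γ ^ (p - 1) * m ^ γ * (m + 1 / 2) ^ (γ * (p - 1)) * |u (k + 1)| ^ p := by
      generalize (m - 1 / 2) ^ (γ * (p - 1)) = A at hA
      field_simp
    have h4 : s ^ (p - 1) * ((p - (p - 1) * (1 - s + s)) * |u k| ^ p -
        (1 - s) ^ (1 - p) * |u (k + 1)| ^ p) * m ^ (p - 1 + γ * p) =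
        γ ^ (p - 1) * m ^ γ * (m - 1 / 2) ^ (γ * (p - 1)) *
          (|u k| ^ p - (1 - s) ^ (1 - p) * |u (k + 1)| ^ p) := by
      rw [← hpow]; ring
    rw [h4]
    linear_combination h2 + h3
  · intro k
    have hm1 : (1 : ℝ) ≤ ((k + 1 : ℕ) : ℝ) := by simp
    generalize ((k + 1 : ℕ) : ℝ) = m at *
    have hm0 : 0 < m := by linarith
    have key : γ * m ^ (γ * p - 1) ≤
        (m + 1 / 2) ^ (γ * (p - 1)) * ((m + 1) ^ γ - m ^ γ) := by
      -- for `γ ≤ 1` the midpoint rule beats the centred factor, for `1 ≤ γ` Bernoulli suffices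
      rcases le_total γ 1 with h1 | h1
      · have hmid := rpow_sub_one_le_midpoint (β := γ) (m := m + 1 / 2) h1 hγ.ne' (by linarith)
        rw [add_sub_cancel_right, show m + 1 / 2 + 1 / 2 = m + 1 by ring, le_div_iff₀ hγ] at hmid
        calc γ * m ^ (γ * p - 1) ≤ γ * (m + 1 / 2) ^ (γ * p - 1) := by
              gcongr
              linarith
          _ = (m + 1 / 2) ^ (γ * (p - 1)) * ((m + 1 / 2) ^ (γ - 1) * γ) := by
              rw [← mul_assoc, ← Real.rpow_add (by positivity)]; ring_nf
          _ ≤ _ := by gcongr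
      · have hb := one_add_mul_self_le_rpow_one_add (s := 1 / m)
          (by linarith [show 0 < 1 / m by positivity]) h1
        have hb' : γ * m ^ (γ - 1) ≤ (m + 1) ^ γ - m ^ γ := by
          have e : m + 1 = m * (1 + 1 / m) := by field_simp
          rw [e, Real.mul_rpow hm0.le (by positivity), Real.rpow_sub_one hm0.ne']
          have := mul_le_mul_of_nonneg_left hb (Real.rpow_nonneg hm0.le γ)
          linear_combination this
        calc γ * m ^ (γ * p - 1) = m ^ (γ * (p - 1)) * (γ * m ^ (γ - 1)) := by
              rw [mul_left_comm, ← Real.rpow_add hm0]; ring_nf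
          _ ≤ _ := by gcongr; linarith
    have := mul_le_mul_of_nonneg_left key (Real.rpow_nonneg hγ.le (p - 1))
    rw [show p - 1 + γ * p - p = γ * p - 1 by ring, rpow_eq_rpow_sub_one_mul hγ p]
    linear_combination this

theorem disc_hardy {p α : ℝ} (hp : 1 < p) (hα : 0 ≤ α) (hαp : α ≠ p - 1) {u : ℕ → ℝ}
    (hu : u ∈ HardySeq) :
    |(α - p + 1) / p| ^ p * discPotential p α u ≤ discEnergy p α u := by
  have hp0 : 0 < p := by linarith
  rcases lt_or_gt_of_ne hαp with h | h
  · obtain ⟨γ, hγ⟩ : ∃ γ, γ = (p - 1 - α) / p := ⟨_, rfl⟩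
    have hγ0 : 0 < γ := by rw [hγ]; exact div_pos (by linarith) hp0
    obtain rfl : α = p - 1 - γ * p := by rw [hγ]; field_simp; ring
    rw [show (p - 1 - γ * p - p + 1) / p = -γ by field_simp; ring, abs_neg, abs_of_pos hγ0]
    exact disc_hardy_neg hp hγ0 hα hu
  · obtain ⟨γ, hγ⟩ : ∃ γ, γ = (α - p + 1) / p := ⟨_, rfl⟩
    have hγ0 : 0 < γ := by rw [hγ]; exact div_pos (by linarith) hp0
    obtain rfl : α = p - 1 + γ * p := by rw [hγ]; field_simp; ring
    rw [← hγ, abs_of_pos hγ0]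
    rcases le_total (γ * p) 1 with hc | hc
    · exact disc_hardy_pos_of_le_one hp hγ0 hc hu
    · exact disc_hardy_pos_of_one_le hp hγ0 hc hu

/-! ### Sampling a test function on a fine grid -/

theorem integral_floor_eq_tsum {G : ℕ → ℝ} {M : ℕ} (hG : ∀ n, M ≤ n → G n = 0) :
    ∫ x in Set.Ioi (0 : ℝ), G ⌊x⌋₊ = ∑' k, G k := by
  have hstep : ∀ k : ℕ, Set.EqOn (fun x : ℝ => G ⌊x⌋₊) (fun _ => G k)
      (Set.Ico (k : ℝ) (k + 1 : ℕ)) := fun k x hx => by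
    have : ⌊x⌋₊ = k := (Nat.floor_eq_iff ((Nat.cast_nonneg k).trans hx.1)).2
      ⟨hx.1, by simpa using hx.2⟩
    simp [this]
  have hint : ∀ k : ℕ, IntervalIntegrable (fun x : ℝ => G ⌊x⌋₊) volume k (k + 1 : ℕ) := by
    intro k
    rw [intervalIntegrable_iff_integrableOn_Ico_of_le (by simp)]
    exact (integrableOn_const (by simp)).congr_fun (fun x hx => (hstep k hx).symm)
      measurableSet_Ico
  have hval : ∀ k : ℕ, ∫ x in (k : ℝ)..(k + 1 : ℕ), G ⌊x⌋₊ = G k := by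
    intro k
    rw [intervalIntegral.integral_of_le (by simp), integral_Ioc_eq_integral_Ioo,
      setIntegral_congr_fun measurableSet_Ioo
        (fun x hx => hstep k (Set.Ioo_subset_Ico_self hx))]
    simp
  rw [tsum_eq_sum (s := Finset.range M) fun k hk => hG k (by simpa using hk),
    ← Finset.sum_congr rfl fun k _ => hval k,
    intervalIntegral.sum_integral_adjacent_intervals fun k _ => hint k,
    intervalIntegral.integral_of_le (by simp), Nat.cast_zero]
  refine (setIntegral_eq_of_subset_of_forall_sdiff_eq_zero measurableSet_Ioi
    Set.Ioc_subset_Ioi_self fun x hx => ?_)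
  have hx2 : (M : ℝ) < x := by
    by_contra h
    exact hx.2 ⟨hx.1, not_lt.1 h⟩
  exact hG _ (Nat.le_floor hx2.le)

/-- Convergence of generalized Riemann sums of mesh `1 / N`: the entries `a N k` need not be values
of `F`, only converge to `F x` along the grid cell `k / N ≤ x < (k + 1) / N`. -/
theorem tendsto_step_sum_integral {a : ℕ → ℕ → ℝ} {F : ℝ → ℝ} {R : ℕ} {B : ℝ}
    (hsupp : ∀ N k, R * N ≤ k → a N k = 0) (hbound : ∀ N k, |a N k| ≤ B)
    (hlim : ∀ x : ℝ, 0 < x → Tendsto (fun N : ℕ => a N ⌊(N : ℝ) * x⌋₊) atTop (𝓝 (F x))) :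
    Tendsto (fun N : ℕ => (N : ℝ)⁻¹ * ∑' k, a N k) atTop
      (𝓝 (∫ x in Set.Ioi (0 : ℝ), F x)) := by
  have hB : 0 ≤ B := (abs_nonneg _).trans (hbound 0 0)
  have key : Tendsto (fun N : ℕ => ∫ x in Set.Ioi (0 : ℝ), a N ⌊(N : ℝ) * x⌋₊) atTop
      (𝓝 (∫ x in Set.Ioi (0 : ℝ), F x)) := by
    refine tendsto_integral_of_dominated_convergence
      ((Set.Ioc (0 : ℝ) R).indicator fun _ => B) ?_ ?_ ?_ ?_
    · intro N
      exact ((measurable_of_countable (a N)).comp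
        (Nat.measurable_floor.comp (measurable_const_mul _))).aestronglyMeasurable
    · refine Integrable.integrableOn ?_
      rw [integrable_indicator_iff measurableSet_Ioc]
      exact integrableOn_const (by simp)
    · intro N
      refine (ae_restrict_mem measurableSet_Ioi).mono fun x hx => ?_
      by_cases hxR : x ≤ R
      · rw [Set.indicator_of_mem (show x ∈ Set.Ioc (0 : ℝ) R from ⟨hx, hxR⟩)]
        exact hbound _ _
      · rw [hsupp, norm_zero]
        · exact Set.indicator_nonneg (fun _ _ => hB) x
        · refine Nat.le_floor ?_
          push_cast
          rw [mul_comm]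
          exact mul_le_mul_of_nonneg_left (not_le.1 hxR).le (Nat.cast_nonneg N)
    · exact (ae_restrict_mem measurableSet_Ioi).mono fun x hx => hlim x hx
  refine key.congr' ?_
  filter_upwards [eventually_gt_atTop 0] with N hN
  have hN : (0 : ℝ) < N := by exact_mod_cast hN
  rw [integral_comp_mul_left_Ioi (fun y => a N ⌊y⌋₊) 0 hN, mul_zero,
    integral_floor_eq_tsum (hsupp N), smul_eq_mul]

theorem tendsto_floor_mul_div {x : ℝ} (hx : 0 ≤ x) :
    Tendsto (fun N : ℕ => (⌊(N : ℝ) * x⌋₊ : ℝ) / N) atTop (𝓝 x) := by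
  have := (tendsto_nat_floor_mul_div_atTop hx).comp (tendsto_natCast_atTop_atTop (R := ℝ))
  refine this.congr fun N => ?_
  simp [mul_comm]

theorem tendsto_floor_mul_add_one_div {x : ℝ} (hx : 0 ≤ x) :
    Tendsto (fun N : ℕ => ((⌊(N : ℝ) * x⌋₊ + 1 : ℕ) : ℝ) / N) atTop (𝓝 x) := by
  have := (tendsto_floor_mul_div hx).add (tendsto_one_div_atTop_nhds_zero_nat (𝕜 := ℝ))
  rw [add_zero] at this
  refine this.congr fun N => ?_
  push_cast
  rw [add_div]

theorem HardyTest.exists_bound {φ : ℝ → ℝ} (hφ : φ ∈ HardyTest) :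
    ∃ R : ℕ, ∀ x, (R : ℝ) ≤ x → φ x = 0 := by
  obtain ⟨r, hr⟩ := hφ.2.1.isCompact.isBounded.bddAbove
  obtain ⟨R, hR⟩ := exists_nat_gt r
  refine ⟨R, fun x hx => ?_⟩
  by_contra h
  linarith [hr (subset_tsupport φ (Function.mem_support.2 h))]

theorem HardyTest.eventuallyEq_zero {φ : ℝ → ℝ} (hφ : φ ∈ HardyTest) {x : ℝ} (hx : x ≤ 0) :
    φ =ᶠ[𝓝 x] 0 :=
  notMem_tsupport_iff_eventuallyEq.1 fun h => (not_lt.2 hx) (hφ.2.2 h)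

/-- The sequence of values of `φ` on the grid of mesh `1 / N`. -/
noncomputable def gridSample (φ : ℝ → ℝ) (N k : ℕ) : ℝ := φ (k / N)

theorem gridSample_mem {φ : ℝ → ℝ} (hφ : φ ∈ HardyTest) {N : ℕ} (hN : 0 < N) :
    gridSample φ N ∈ HardySeq := by
  obtain ⟨R, hR⟩ := HardyTest.exists_bound hφ
  have hN' : (0 : ℝ) < N := by exact_mod_cast hN
  refine ⟨(Set.finite_lt_nat (R * N)).subset fun k hk => ?_, ?_⟩
  · by_contra h
    refine hk (hR _ ?_)
    rw [le_div_iff₀ hN']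
    exact_mod_cast not_lt.1 h
  · simpa [gridSample] using (HardyTest.eventuallyEq_zero hφ le_rfl).self_of_nhds

theorem tendsto_potential_gridSample {p α : ℝ} (hp : 1 < p) {φ : ℝ → ℝ} (hφ : φ ∈ HardyTest) :
    Tendsto (fun N : ℕ => (N : ℝ)⁻¹ *
        ∑' k : ℕ, |φ ((k + 1 : ℕ) / N)| ^ p * (((k + 1 : ℕ) : ℝ) / N) ^ (α - p)) atTop
      (𝓝 (contPotential p α φ)) := by
  obtain ⟨R, hR⟩ := HardyTest.exists_bound hφ
  have hp0 : p ≠ 0 := by linarith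
  set F : ℝ → ℝ := fun x => |φ x| ^ p * x ^ (α - p) with hF
  have hFc : Continuous F := by
    refine continuous_iff_continuousAt.2 fun x => ?_
    rcases le_or_gt x 0 with hx | hx
    · refine (continuousAt_const (y := (0 : ℝ))).congr ?_
      filter_upwards [HardyTest.eventuallyEq_zero hφ hx] with y hy
      simp [hF, hy, Real.zero_rpow hp0]
    · exact ((hφ.1.continuous.abs.rpow_const fun _ => Or.inr (by linarith)).continuousAt).mul
        (Real.continuousAt_rpow_const _ _ (Or.inl hx.ne'))
  have hFs : HasCompactSupport F := by
    refine hφ.2.1.mono fun x hx => ?_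
    rw [Function.mem_support] at hx ⊢
    contrapose! hx
    simp [hF, hx, Real.zero_rpow hp0]
  obtain ⟨B, hB⟩ := hFs.exists_bound_of_continuous hFc
  refine tendsto_step_sum_integral (a := fun N k => F (((k + 1 : ℕ) : ℝ) / N)) (R := R) (B := B)
    ?_ (fun N k => hB _) ?_
  · intro N k hk
    rcases Nat.eq_zero_or_pos N with rfl | hN
    · simp [hF, (HardyTest.eventuallyEq_zero hφ le_rfl).self_of_nhds, Real.zero_rpow hp0]
    have hN' : (0 : ℝ) < N := by exact_mod_cast hN
    have : φ (((k + 1 : ℕ) : ℝ) / N) = 0 := hR _ (by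
      rw [le_div_iff₀ hN']
      exact_mod_cast hk.trans (Nat.le_succ k))
    simp only [hF, this, abs_zero, Real.zero_rpow hp0, zero_mul]
  · exact fun x hx => (hFc.tendsto x).comp (tendsto_floor_mul_add_one_div hx.le)

theorem tendsto_energy_gridSample {p α : ℝ} (hp : 1 < p) (hα : 0 ≤ α) {φ : ℝ → ℝ}
    (hφ : φ ∈ HardyTest) :
    Tendsto (fun N : ℕ => (N : ℝ)⁻¹ * ∑' k : ℕ,
        |N * (φ ((k + 1 : ℕ) / N) - φ (k / N))| ^ p * (((k + 1 : ℕ) : ℝ) / N) ^ α) atTop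
      (𝓝 (contEnergy p α φ)) := by
  obtain ⟨R, hR⟩ := HardyTest.exists_bound hφ
  have hp0 : p ≠ 0 := by linarith
  obtain ⟨L, hL⟩ := hφ.1.lipschitzWith_of_hasCompactSupport hφ.2.1 (by simp)
  have hsupp : ∀ N k, R * N ≤ k → |N * (φ ((k + 1 : ℕ) / N) - φ (k / N))| ^ p *
      (((k + 1 : ℕ) : ℝ) / N) ^ α = 0 := by
    intro N k hk
    rcases Nat.eq_zero_or_pos N with rfl | hN
    · simp [Real.zero_rpow hp0]
    have hN' : (0 : ℝ) < N := by exact_mod_cast hN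
    rw [hR _ (by rw [le_div_iff₀ hN']; exact_mod_cast hk.trans (Nat.le_succ k)),
      hR _ (by rw [le_div_iff₀ hN']; exact_mod_cast hk)]
    simp [Real.zero_rpow hp0]
  refine tendsto_step_sum_integral (R := R) (B := (L : ℝ) ^ p * (R : ℝ) ^ α) hsupp ?_ ?_
  · intro N k
    rcases le_or_gt (R * N) k with hk | hk
    · rw [hsupp N k hk, abs_zero]
      positivity
    have hN : 0 < N := Nat.pos_of_ne_zero fun h => by simp [h] at hk
    have hN' : (0 : ℝ) < N := by exact_mod_cast hN
    rw [abs_of_nonneg (by positivity)]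
    gcongr
    · have h := hL.dist_le_mul ((k + 1 : ℕ) / N) (k / N)
      rw [Real.dist_eq, Real.dist_eq, ← sub_div] at h
      rw [abs_mul, Nat.abs_cast]
      calc (N : ℝ) * |φ ((k + 1 : ℕ) / N) - φ (k / N)| ≤
            N * (L * |(((k + 1 : ℕ) : ℝ) - k) / N|) := by gcongr
        _ = L := by
          rw [show (((k + 1 : ℕ) : ℝ) - k) / N = 1 / N by push_cast; ring,
            abs_of_pos (by positivity)]
          field_simp
    · rw [div_le_iff₀ hN']
      exact_mod_cast hk
  · intro x hx
    have h0 := tendsto_floor_mul_div hx.le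
    have h1 := tendsto_floor_mul_add_one_div hx.le
    have hd : HasStrictDerivAt φ (deriv φ x) x := hφ.1.contDiffAt.hasStrictDerivAt (by simp)
    have hslope : Tendsto (fun N : ℕ => (N : ℝ) *
        (φ ((⌊(N : ℝ) * x⌋₊ + 1 : ℕ) / N) - φ (⌊(N : ℝ) * x⌋₊ / N))) atTop
        (𝓝 (deriv φ x)) := by
      -- strict differentiability, as both grid points move with `N`
      have ho := hd.hasStrictFDerivAt.isLittleO.comp_tendsto (h1.prodMk_nhds h0)
      have ht := ho.tendsto_div_nhds_zero
      have := ht.add_const (deriv φ x)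
      rw [zero_add] at this
      refine this.congr' ?_
      filter_upwards [eventually_gt_atTop 0] with N hN
      have hN' : (0 : ℝ) < N := by exact_mod_cast hN
      simp only [Function.comp]
      rw [show ((⌊(N : ℝ) * x⌋₊ + 1 : ℕ) : ℝ) / N - ⌊(N : ℝ) * x⌋₊ / N = 1 / N by
        push_cast; ring]
      simp only [ContinuousLinearMap.toSpanSingleton_apply, smul_eq_mul]
      field_simp
      ring
    exact (hslope.abs.rpow_const (Or.inr (by linarith))).mul
      (h1.rpow_const (Or.inl hx.ne'))

theorem discPotential_gridSample {p α : ℝ} (φ : ℝ → ℝ) {N : ℕ} (hN : 0 < N) :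
    discPotential p α (gridSample φ N) = (N : ℝ) ^ (α - p + 1) * ((N : ℝ)⁻¹ *
      ∑' k : ℕ, |φ ((k + 1 : ℕ) / N)| ^ p * (((k + 1 : ℕ) : ℝ) / N) ^ (α - p)) := by
  have hN' : (0 : ℝ) < N := by exact_mod_cast hN
  rw [← mul_assoc, Real.rpow_add_one hN'.ne', mul_assoc _ (N : ℝ), mul_inv_cancel₀ hN'.ne',
    mul_one, ← tsum_mul_left]
  refine tsum_congr fun k => ?_
  rw [Real.div_rpow (by positivity) hN'.le, gridSample]
  field_simp

theorem discEnergy_gridSample {p α : ℝ} (φ : ℝ → ℝ) {N : ℕ} (hN : 0 < N) :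
    discEnergy p α (gridSample φ N) = (N : ℝ) ^ (α - p + 1) * ((N : ℝ)⁻¹ * ∑' k : ℕ,
        |N * (φ ((k + 1 : ℕ) / N) - φ (k / N))| ^ p * (((k + 1 : ℕ) : ℝ) / N) ^ α) := by
  have hN' : (0 : ℝ) < N := by exact_mod_cast hN
  rw [← mul_assoc, Real.rpow_add_one hN'.ne', mul_assoc _ (N : ℝ), mul_inv_cancel₀ hN'.ne',
    mul_one, ← tsum_mul_left]
  refine tsum_congr fun k => ?_
  rw [Real.div_rpow (by positivity) hN'.le, gridSample, gridSample, abs_mul, Nat.abs_cast,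
    Real.mul_rpow hN'.le (abs_nonneg _), Real.rpow_sub hN']
  field_simp

/-- The continuous inequality, as the limit of the discrete inequality for the samples of `φ`. -/
theorem cont_hardy {p α : ℝ} (hp : 1 < p) (hα : 0 ≤ α) (hαp : α ≠ p - 1) {φ : ℝ → ℝ}
    (hφ : φ ∈ HardyTest) :
    |(α - p + 1) / p| ^ p * contPotential p α φ ≤ contEnergy p α φ := by
  refine le_of_tendsto_of_tendsto ((tendsto_potential_gridSample hp hφ).const_mul _)
    (tendsto_energy_gridSample hp hα hφ) ?_
  filter_upwards [eventually_gt_atTop 0] with N hN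
  have hN' : (0 : ℝ) < N := by exact_mod_cast hN
  have h := disc_hardy hp hα hαp (gridSample_mem hφ hN)
  rw [discPotential_gridSample φ hN, discEnergy_gridSample φ hN, mul_left_comm] at h
  exact le_of_mul_le_mul_left h (by positivity)

/-- A strict inequality between energy and potential of a test function is inherited by its samples
on a fine grid. -/
theorem exists_hardySeq_of_hardyTest {p α C t : ℝ} (hp : 1 < p) (hα : 0 ≤ α) {φ : ℝ → ℝ}
    (hφ : φ ∈ HardyTest) (h : t * contEnergy p α φ < C * contPotential p α φ) :
    ∃ u ∈ HardySeq, t * discEnergy p α u < C * discPotential p α u := by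
  have hev := ((tendsto_energy_gridSample hp hα hφ).const_mul t).eventually_lt
    ((tendsto_potential_gridSample hp hφ).const_mul C) h
  obtain ⟨N, hlt, hN⟩ := (hev.and (eventually_gt_atTop 0)).exists
  refine ⟨gridSample φ N, gridSample_mem hφ hN, ?_⟩
  have hN' : (0 : ℝ) < N := by exact_mod_cast hN
  rw [discPotential_gridSample φ hN, discEnergy_gridSample φ hN, mul_left_comm t,
    mul_left_comm C]
  exact mul_lt_mul_of_pos_left hlt (by positivity)

/-! ### Almost extremal test functions -/

/-- Substitution `x = exp s`; no integrability of `g` is needed. -/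
theorem integral_Ioi_inv_mul_comp_log (g : ℝ → ℝ) :
    ∫ x in Set.Ioi (0 : ℝ), x⁻¹ * g (Real.log x) = ∫ s, g s := by
  have h := integral_image_eq_integral_abs_deriv_smul (s := Set.univ) MeasurableSet.univ
    (fun x _ => (Real.hasDerivAt_exp x).hasDerivWithinAt) Real.exp_injective.injOn
    (fun x => x⁻¹ * g (Real.log x))
  rw [Set.image_univ, Real.range_exp, setIntegral_univ] at h
  rw [h]
  refine integral_congr_ae (Eventually.of_forall fun s => ?_)
  simp [abs_of_pos (Real.exp_pos s)]

/-- A smooth bump function on the line: it equals one on `[-1, 1]` and is supported in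
`[-2, 2]`. -/
noncomputable def cutoff : ContDiffBump (0 : ℝ) where
  rIn := 1
  rOut := 2
  rIn_pos := one_pos
  rIn_lt_rOut := one_lt_two

theorem cutoff_eq_zero {s : ℝ} (hs : 2 ≤ |s|) : cutoff s = 0 :=
  cutoff.zero_of_le_dist (by simpa [Real.dist_eq, cutoff] using hs)

theorem deriv_cutoff_eq_zero {s : ℝ} (hs : 2 < |s|) : deriv cutoff s = 0 := by
  have : (cutoff : ℝ → ℝ) =ᶠ[𝓝 s] fun _ => 0 := by
    filter_upwards [continuous_abs.continuousAt.eventually (lt_mem_nhds hs)] with y hy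
    exact cutoff_eq_zero hy.le
  rw [this.deriv_eq, deriv_const]

/-- The power `x ^ (-κ)` cut off smoothly, with respect to the variable `log x`, at the
scale `1 / ε`; it vanishes for `x ≤ 0`. -/
noncomputable def truncatedPower (κ ε x : ℝ) : ℝ :=
  if 0 < x then x ^ (-κ) * cutoff (ε * Real.log x) else 0

theorem truncatedPower_of_pos {κ ε x : ℝ} (hx : 0 < x) :
    truncatedPower κ ε x = x ^ (-κ) * cutoff (ε * Real.log x) := if_pos hx

theorem support_truncatedPower_subset {κ ε : ℝ} (hε : 0 < ε) :
    Function.support (truncatedPower κ ε) ⊆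
      Set.Icc (Real.exp (-(2 / ε))) (Real.exp (2 / ε)) := by
  intro x hx
  have hx0 : 0 < x := by
    by_contra h
    exact hx (if_neg h)
  have hlog : |ε * Real.log x| < 2 := by
    by_contra h
    exact hx (by rw [truncatedPower_of_pos hx0, cutoff_eq_zero (not_lt.1 h), mul_zero])
  obtain ⟨h1, h2⟩ := abs_lt.1 hlog
  constructor
  · rw [← Real.le_log_iff_exp_le hx0, ← neg_div, div_le_iff₀ hε]
    linarith
  · rw [← Real.log_le_iff_le_exp hx0, le_div_iff₀ hε]
    linarith

theorem truncatedPower_mem (κ : ℝ) {ε : ℝ} (hε : 0 < ε) : truncatedPower κ ε ∈ HardyTest := by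
  have hsub := support_truncatedPower_subset (κ := κ) hε
  have htsub : tsupport (truncatedPower κ ε) ⊆
      Set.Icc (Real.exp (-(2 / ε))) (Real.exp (2 / ε)) := closure_minimal hsub isClosed_Icc
  refine ⟨contDiff_iff_contDiffAt.2 fun x => ?_,
    isCompact_Icc.of_isClosed_subset (isClosed_tsupport _) htsub,
    fun x hx => (Real.exp_pos _).trans_le (htsub hx).1⟩
  rcases le_or_gt x 0 with hx | hx
  · have : truncatedPower κ ε =ᶠ[𝓝 x] 0 := notMem_tsupport_iff_eventuallyEq.1 fun h =>
      (not_lt.2 hx) ((Real.exp_pos _).trans_le (htsub h).1)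
    exact contDiffAt_const.congr_of_eventuallyEq this
  · have hev : truncatedPower κ ε =ᶠ[𝓝 x] fun y => y ^ (-κ) * cutoff (ε * Real.log y) := by
      filter_upwards [lt_mem_nhds hx] with y hy using truncatedPower_of_pos hy
    refine ContDiffAt.congr_of_eventuallyEq ?_ hev
    refine (Real.contDiffAt_rpow_const_of_ne hx.ne').mul ?_
    exact cutoff.contDiff.contDiffAt.comp x
      (contDiffAt_const.mul (Real.contDiffAt_log.2 hx.ne'))

theorem deriv_truncatedPower (κ ε : ℝ) {x : ℝ} (hx : 0 < x) :
    deriv (truncatedPower κ ε) x = x ^ (-κ - 1) *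
      (ε * deriv cutoff (ε * Real.log x) - κ * cutoff (ε * Real.log x)) := by
  have hev : truncatedPower κ ε =ᶠ[𝓝 x] fun y => y ^ (-κ) * cutoff (ε * Real.log y) := by
    filter_upwards [lt_mem_nhds hx] with y hy using truncatedPower_of_pos hy
  have hc : HasDerivAt cutoff (deriv cutoff (ε * Real.log x)) (ε * Real.log x) :=
    ((cutoff.contDiff (n := 1)).differentiable (by simp) _).hasDerivAt
  have hd := (Real.hasDerivAt_rpow_const (p := -κ) (Or.inl hx.ne')).mul
    (hc.comp x ((Real.hasDerivAt_log hx.ne').const_mul ε))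
  rw [hev.deriv_eq]
  refine hd.deriv.trans ?_
  simp only [Function.comp]
  rw [Real.rpow_sub_one hx.ne']
  field_simp
  ring

/-- In the variable `log x`, the weights of energy and potential both become constant. -/
theorem abs_rpow_mul_rpow {p a b z x : ℝ} (hx : 0 < x) (h : a * p + b = -1) :
    |x ^ a * z| ^ p * x ^ b = x⁻¹ * |z| ^ p := by
  rw [abs_mul, Real.mul_rpow (abs_nonneg _) (abs_nonneg _), abs_of_pos (by positivity),
    ← Real.rpow_mul hx.le, mul_right_comm, ← Real.rpow_add hx, h, Real.rpow_neg_one]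

theorem contPotential_truncatedPower {p α ε : ℝ} (hp : 1 < p) (hε : 0 < ε) :
    contPotential p α (truncatedPower ((α - p + 1) / p) ε) = ε⁻¹ * ∫ s, |cutoff s| ^ p := by
  have h0 : p ≠ 0 := by linarith
  calc _ = ∫ x in Set.Ioi (0 : ℝ), x⁻¹ * |cutoff (ε * Real.log x)| ^ p := by
        refine setIntegral_congr_fun measurableSet_Ioi fun x hx => ?_
        rw [truncatedPower_of_pos hx]
        exact abs_rpow_mul_rpow hx (by field_simp; ring)
    _ = ∫ s, |cutoff (ε * s)| ^ p :=
        integral_Ioi_inv_mul_comp_log fun s => |cutoff (ε * s)| ^ p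
    _ = _ := by
        rw [Measure.integral_comp_mul_left (fun s => |cutoff s| ^ p),
          abs_of_pos (inv_pos.2 hε), smul_eq_mul]

theorem contEnergy_truncatedPower {p α ε : ℝ} (hp : 1 < p) (hε : 0 < ε) :
    contEnergy p α (truncatedPower ((α - p + 1) / p) ε) =
      ε⁻¹ * ∫ s, |ε * deriv cutoff s - (α - p + 1) / p * cutoff s| ^ p := by
  have h0 : p ≠ 0 := by linarith
  set κ := (α - p + 1) / p with hκ
  calc _ = ∫ x in Set.Ioi (0 : ℝ), x⁻¹ *
          |ε * deriv cutoff (ε * Real.log x) - κ * cutoff (ε * Real.log x)| ^ p := by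
        refine setIntegral_congr_fun measurableSet_Ioi fun x hx => ?_
        rw [deriv_truncatedPower κ ε hx]
        exact abs_rpow_mul_rpow hx (by rw [hκ]; field_simp; ring)
    _ = ∫ s, |ε * deriv cutoff (ε * s) - κ * cutoff (ε * s)| ^ p :=
        integral_Ioi_inv_mul_comp_log
          fun s => |ε * deriv cutoff (ε * s) - κ * cutoff (ε * s)| ^ p
    _ = _ := by
        rw [Measure.integral_comp_mul_left
          (fun s => |ε * deriv cutoff s - κ * cutoff s| ^ p),
          abs_of_pos (inv_pos.2 hε), smul_eq_mul]

theorem continuous_deriv_cutoff : Continuous (deriv cutoff) :=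
  (cutoff.contDiff (n := 1)).continuous_deriv le_rfl

theorem continuous_integral_cutoff {p : ℝ} (hp : 1 < p) (κ : ℝ) :
    Continuous fun ε : ℝ => ∫ s, |ε * deriv cutoff s - κ * cutoff s| ^ p := by
  have hset : ∀ ε : ℝ, ∫ s in Set.Icc (-2 : ℝ) 2, |ε * deriv cutoff s - κ * cutoff s| ^ p =
      ∫ s, |ε * deriv cutoff s - κ * cutoff s| ^ p := by
    refine fun ε => setIntegral_eq_integral_of_forall_compl_eq_zero fun s hs => ?_
    have hs : 2 < |s| := by
      by_contra h
      exact hs (abs_le.1 (not_lt.1 h))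
    rw [deriv_cutoff_eq_zero hs, cutoff_eq_zero hs.le]
    simp [Real.zero_rpow (show p ≠ 0 by linarith)]
  simp_rw [← hset]
  refine continuous_parametric_integral_of_continuous
    (f := fun ε s : ℝ => |ε * deriv cutoff s - κ * cutoff s| ^ p) ?_ isCompact_Icc
  refine Continuous.rpow_const ?_ fun _ => Or.inr (by linarith)
  have h1 := continuous_deriv_cutoff
  have h2 := cutoff.continuous
  fun_prop

theorem integral_cutoff_rpow_pos {p : ℝ} (hp : 1 < p) : 0 < ∫ s, |cutoff s| ^ p := by
  have hp0 : p ≠ 0 := by linarith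
  refine Continuous.integral_pos_of_hasCompactSupport_nonneg_nonzero (x := (0 : ℝ)) ?_ ?_ ?_ ?_
  · exact cutoff.continuous.abs.rpow_const fun _ => Or.inr (by linarith)
  · refine cutoff.hasCompactSupport.mono fun x hx => ?_
    rw [Function.mem_support] at hx ⊢
    contrapose! hx
    simp [hx, Real.zero_rpow hp0]
  · exact fun s => Real.rpow_nonneg (abs_nonneg _) p
  · rw [cutoff.one_of_mem_closedBall (by simp [cutoff])]
    simp

theorem exists_hardyTest_almost_equality {p α t : ℝ} (hp : 1 < p) (hαp : α ≠ p - 1)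
    (ht : t < 1) : ∃ φ ∈ HardyTest,
      t * contEnergy p α φ < |(α - p + 1) / p| ^ p * contPotential p α φ := by
  have hκ : (α - p + 1) / p ≠ 0 :=
    div_ne_zero (fun h => hαp (by linarith)) (by linarith)
  have hC : 0 < |(α - p + 1) / p| ^ p := Real.rpow_pos_of_pos (abs_pos.2 hκ) p
  have hI := integral_cutoff_rpow_pos hp
  have hcont := (continuous_integral_cutoff hp ((α - p + 1) / p)).const_mul t |>.tendsto 0
  have h0 : ∫ s, |(0 : ℝ) * deriv cutoff s - (α - p + 1) / p * cutoff s| ^ p =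
      |(α - p + 1) / p| ^ p * ∫ s, |cutoff s| ^ p := by
    rw [← integral_const_mul]
    refine integral_congr_ae (Eventually.of_forall fun s => ?_)
    simp only [zero_mul, zero_sub, abs_neg, abs_mul]
    exact Real.mul_rpow (abs_nonneg _) (abs_nonneg _)
  have hlt : t * ∫ s, |(0 : ℝ) * deriv cutoff s - (α - p + 1) / p * cutoff s| ^ p <
      |(α - p + 1) / p| ^ p * ∫ s, |cutoff s| ^ p := by
    rw [h0]
    exact mul_lt_of_lt_one_left (mul_pos hC hI) ht
  have hev := (hcont.eventually_lt_const hlt).filter_mono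
    (nhdsWithin_le_nhds (s := Set.Ioi 0))
  obtain ⟨ε, hε, hpos⟩ := (hev.and self_mem_nhdsWithin).exists
  have hpos : 0 < ε := hpos
  refine ⟨truncatedPower ((α - p + 1) / p) ε, truncatedPower_mem _ hpos, ?_⟩
  rw [contEnergy_truncatedPower hp hpos, contPotential_truncatedPower hp hpos,
    mul_left_comm t, mul_left_comm (_ ^ p)]
  exact mul_lt_mul_of_pos_left hε (inv_pos.2 hpos)

/-- If equality with the constant `C` is attained up to any factor `t < 1`, no larger constant is
admissible. -/
theorem le_of_almost_equality {ι : Type*} {S : Set ι} {E V : ι → ℝ} {A C : ℝ} (hC : 0 < C)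
    (hA : ∀ i ∈ S, A * V i ≤ E i) (hsharp : ∀ t : ℝ, t < 1 → ∃ i ∈ S, t * E i < C * V i) :
    A ≤ C := by
  by_contra! h
  have hA0 : 0 < A := hC.trans h
  obtain ⟨i, hi, hlt⟩ := hsharp (C / A) ((div_lt_one hA0).2 h)
  have := mul_le_mul_of_nonneg_left (hA i hi) (div_nonneg hC.le hA0.le)
  rw [← mul_assoc, div_mul_cancel₀ _ hA0.ne'] at this
  linarith

theorem theorem4p5 (p α : ℝ) (hp : 1 < p) (hα : 0 ≤ α) (hαp : α ≠ p - 1) :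
    -- the discrete inequality
    (∀ u : ℕ → ℝ, u ∈ HardySeq →
      |(α - p + 1) / p| ^ p * discPotential p α u ≤ discEnergy p α u) ∧
    -- the constant is the sharp (largest) constant of the discrete inequality
    IsGreatest (discHardyConstants p α) (|(α - p + 1) / p| ^ p) ∧
    -- and it is the sharp (largest) constant of the continuous inequality
    IsGreatest (contHardyConstants p α) (|(α - p + 1) / p| ^ p) ∧
    -- sharpness of the discrete inequality, as nearly attained equality
    (∀ t : ℝ, t < 1 → ∃ u ∈ HardySeq,
      t * discEnergy p α u < |(α - p + 1) / p| ^ p * discPotential p α u) := by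
  have hκ : (α - p + 1) / p ≠ 0 :=
    div_ne_zero (fun h => hαp (by linarith)) (by linarith)
  have hC : 0 < |(α - p + 1) / p| ^ p := Real.rpow_pos_of_pos (abs_pos.2 hκ) p
  have hcont : ∀ t : ℝ, t < 1 → ∃ φ ∈ HardyTest,
      t * contEnergy p α φ < |(α - p + 1) / p| ^ p * contPotential p α φ :=
    fun t ht => exists_hardyTest_almost_equality hp hαp ht
  have hdisc : ∀ t : ℝ, t < 1 → ∃ u ∈ HardySeq,
      t * discEnergy p α u < |(α - p + 1) / p| ^ p * discPotential p α u := fun t ht => by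
    obtain ⟨φ, hφ, h⟩ := hcont t ht
    exact exists_hardySeq_of_hardyTest hp hα hφ h
  exact ⟨fun u hu => disc_hardy hp hα hαp hu,
    ⟨fun u hu => disc_hardy hp hα hαp hu, fun A hA => le_of_almost_equality hC hA hdisc⟩,
    ⟨fun φ hφ => cont_hardy hp hα hαp hφ, fun A hA => le_of_almost_equality hC hA hcont⟩,
    hdisc⟩
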